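/- A flow $(X,T)$ is a compact Hausdorff space $X$ together with a homeomorphism $T:X\to X$. It is minimal if the orbit $\{T^n x : n\in\mathbb{Z}\}$ of every point $x\in X$ is dense in $X$, uniquely ergodic if there is exactly one $T$-invariant regular Borel probability measure on $X$, and strictly ergodic if it is both minimal and uniquely ergodic. Let $\mathcal{W}$ (the Weyl algebra) be the smallest norm-closed, translation invariant subalgebra of $\ell^\infty(\mathbb{Z})$ (complex-valued bounded functions on $\mathbb{Z}$) that contains all the functions $n\mapsto e^{2\pi i n^k\alpha}$ with $\alpha\in\mathbb{R}$ and $k\in\mathbb{N}$. Let $|\mathcal{W}|$ be its Gelfand space, that is, the compact space of nonzero multiplicative linear functionals on $\mathcal{W}$ with the topology of pointwise convergence, and let $T:|\mathcal{W}|\to|\mathcal{W}|$ be the homeomorphism induced by translation, $(T\varphi)(f)=\varphi(n\mapsto f(n+1))$. For $f\in\ell^\infty(\mathbb{Z})$ let $X_f$ be the closure of the orbit of $f$ under the shift $(Tx)(n)=x(n+1)$ in $\mathbb{C}^{\mathbb{Z}}$ with the product topology; $(X_f,T)$ is a flow. Theorem. The flow $(|\mathcal{W}|,T)$ is strictly ergodic.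 Hence every function in $\mathcal{W}$ is strictly ergodic; that is, for every $f\in\mathcal{W}$ the flow $(X_f,T)$ is strictly ergodic. -/

import Mathlib

open scoped BoundedContinuousFunction
open MeasureTheory WeakDual

noncomputable section

namespace WeylFlow

/-! ### Flows: self-homeomorphisms of compact Hausdorff spaces -/

section Flow

variable {X : Type*} [TopologicalSpace X] [CompactSpace X] [T2Space X]

/-- A flow `(X, T)` is minimal if the orbit `{T ^ n x : n ∈ ℤ}` of every point is dense. -/
def IsMinimal (T : X ≃ₜ X) : Prop :=
  ∀ x : X, Dense (Set.range fun n : ℤ => (T ^ n) x)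

/-- A flow `(X, T)` is uniquely ergodic if there is exactly one `T`-invariant regular Borel
probability measure on `X`. (For compact metrizable `X` regularity is automatic.) -/
def IsUniquelyErgodic (T : X ≃ₜ X) : Prop :=
  letI : MeasurableSpace X := borel X
  ∃! μ : Measure X, IsProbabilityMeasure μ ∧ μ.Regular ∧ MeasurePreserving T μ μ

/-- A flow is strictly ergodic if it is uniquely ergodic and minimal. -/
def IsStrictlyErgodic (T : X ≃ₜ X) : Prop :=
  IsUniquelyErgodic T ∧ IsMinimal T

end Flow

/-! ### The Weyl algebra

`ℓ^∞(ℤ)` is the Banach algebra `ℤ →ᵇ ℂ` of bounded functions on the discrete space `ℤ`, with the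
supremum norm. -/

/-- The translate `n ↦ f (n + m)`, as an algebra homomorphism in `f`. -/
def translate (m : ℤ) : (ℤ →ᵇ ℂ) →ₐ[ℂ] (ℤ →ᵇ ℂ) where
  toFun f := f.compContinuous ⟨fun n => n + m, continuous_of_discreteTopology⟩
  map_one' := rfl
  map_mul' _ _ := rfl
  map_zero' := rfl
  map_add' _ _ := rfl
  commutes' _ := rfl

@[simp] theorem translate_apply (m : ℤ) (f : ℤ →ᵇ ℂ) (n : ℤ) : translate m f n = f (n + m) := rfl

/-- The function `n ↦ e^{2 π i n ^ k α}`. -/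
def weylFun (α : ℝ) (k : ℕ) : ℤ →ᵇ ℂ :=
  BoundedContinuousFunction.ofNormedAddCommGroupDiscrete
    (fun n : ℤ => Complex.exp (2 * Real.pi * Complex.I * (n : ℂ) ^ k * (α : ℂ))) 1 fun n => by
      have h : 2 * Real.pi * Complex.I * (n : ℂ) ^ k * (α : ℂ)
          = ((2 * Real.pi * (n : ℝ) ^ k * α : ℝ) : ℂ) * Complex.I := by
        push_cast; ring
      rw [h, Complex.norm_exp_ofReal_mul_I]

/-- The Weyl algebra: the smallest closed, translation invariant subalgebra of `ℓ^∞(ℤ)` that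
contains all the functions `n ↦ e^{2 π i n ^ k α}`. -/
def weylAlgebra : Subalgebra ℂ (ℤ →ᵇ ℂ) :=
  sInf {S | IsClosed (S : Set (ℤ →ᵇ ℂ)) ∧ (∀ f ∈ S, ∀ m : ℤ, translate m f ∈ S) ∧
    ∀ (α : ℝ) (k : ℕ), weylFun α k ∈ S}

theorem translate_mem {f : ℤ →ᵇ ℂ} (hf : f ∈ weylAlgebra) (m : ℤ) :
    translate m f ∈ weylAlgebra := by
  rw [weylAlgebra, Algebra.mem_sInf] at hf ⊢
  exact fun S hS => hS.2.1 f (hf S hS) m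

theorem isClosed_weylAlgebra : IsClosed (weylAlgebra : Set (ℤ →ᵇ ℂ)) := by
  rw [weylAlgebra, Algebra.coe_sInf]
  exact isClosed_biInter fun S hS => hS.1

instance : CompleteSpace weylAlgebra := isClosed_weylAlgebra.completeSpace_coe

/-- Translation by `m`, as an algebra endomorphism of the Weyl algebra. -/
def weylTranslate (m : ℤ) : weylAlgebra →ₐ[ℂ] weylAlgebra :=
  ((translate m).comp weylAlgebra.val).codRestrict weylAlgebra fun f => translate_mem f.2 m

theorem continuous_weylTranslate (m : ℤ) : Continuous (weylTranslate m) :=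
  ((BoundedContinuousFunction.continuous_compContinuous _).comp
    continuous_subtype_val).subtype_mk _

/-! ### The Gelfand flow of the Weyl algebra -/

/-- The Gelfand space of the Weyl algebra: its nonzero multiplicative linear functionals with the
topology of pointwise convergence. -/
abbrev GelfandSpace : Type := characterSpace ℂ weylAlgebra

/-- The map `φ ↦ (f ↦ φ (n ↦ f (n + m)))` of the Gelfand space to itself. -/
def gelfandTranslate (m : ℤ) (φ : GelfandSpace) : GelfandSpace :=
  ⟨(φ : WeakDual ℂ weylAlgebra).comp
      (⟨(weylTranslate m).toLinearMap, continuous_weylTranslate m⟩ : weylAlgebra →L[ℂ] weylAlgebra),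
    fun h => one_ne_zero ((map_one φ).symm.trans
      ((congrArg φ (map_one (weylTranslate m)).symm).trans (DFunLike.congr_fun h 1))),
    fun f g => (congrArg φ (map_mul (weylTranslate m) f g)).trans (map_mul φ _ _)⟩

@[simp] theorem gelfandTranslate_apply (m : ℤ) (φ : GelfandSpace) (f : weylAlgebra) :
    gelfandTranslate m φ f = φ (weylTranslate m f) := rfl

theorem continuous_gelfandTranslate (m : ℤ) : Continuous (gelfandTranslate m) :=
  (WeakDual.continuous_of_continuous_eval fun f =>
    (WeakDual.eval_continuous (weylTranslate m f)).comp continuous_subtype_val).subtype_mk _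

/-- The homeomorphism of the Gelfand space induced by the translation `f ↦ (n ↦ f (n + 1))`. -/
def gelfandShift : GelfandSpace ≃ₜ GelfandSpace where
  toFun := gelfandTranslate 1
  invFun := gelfandTranslate (-1)
  left_inv φ := CharacterSpace.ext fun f => by
    have h : weylTranslate 1 (weylTranslate (-1) f) = f := by
      ext n
      exact congrArg (f : ℤ →ᵇ ℂ) (by ring : n + 1 + -1 = n)
    simp [h]
  right_inv φ := CharacterSpace.ext fun f => by
    have h : weylTranslate (-1) (weylTranslate 1 f) = f := by
      ext n
      exact congrArg (f : ℤ →ᵇ ℂ) (by ring : n + -1 + 1 = n)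
    simp [h]
  continuous_toFun := continuous_gelfandTranslate 1
  continuous_invFun := continuous_gelfandTranslate (-1)

/-! ### The orbit closure of a bounded function -/

/-- The shift `(T x) n = x (n + 1)` on `ℂ^ℤ` with the product topology. -/
def bebutovShift : (ℤ → ℂ) ≃ₜ (ℤ → ℂ) where
  toFun x n := x (n + 1)
  invFun x n := x (n - 1)
  left_inv x := by ext n; simp
  right_inv x := by ext n; simp
  continuous_toFun := by fun_prop
  continuous_invFun := by fun_prop

/-- The orbit `{T ^ m f : m ∈ ℤ}` of a bounded function under translation. -/
def orbit (f : ℤ →ᵇ ℂ) : Set (ℤ → ℂ) :=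
  Set.range fun m : ℤ => fun n : ℤ => f (n + m)

/-- The space `X_f`: the orbit closure of `f` in `ℂ^ℤ` with the product topology. -/
def orbitClosure (f : ℤ →ᵇ ℂ) : Set (ℤ → ℂ) :=
  closure (orbit f)

instance (f : ℤ →ᵇ ℂ) : CompactSpace (orbitClosure f) := by
  have hK : IsCompact (Set.univ.pi fun _ : ℤ => Metric.closedBall (0 : ℂ) ‖f‖) :=
    isCompact_univ_pi fun _ => isCompact_closedBall _ _
  refine isCompact_iff_compactSpace.mp (hK.of_isClosed_subset isClosed_closure
    (closure_minimal ?_ hK.isClosed))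
  rintro _ ⟨m, rfl⟩ n -
  simpa using f.norm_coe_le_norm (n + m)

theorem bebutovShift_image_orbit (f : ℤ →ᵇ ℂ) : bebutovShift '' orbit f = orbit f := by
  ext x
  constructor
  · rintro ⟨_, ⟨m, rfl⟩, rfl⟩
    exact ⟨m + 1, funext fun n => congrArg f (by ring)⟩
  · rintro ⟨m, rfl⟩
    exact ⟨_, ⟨m - 1, rfl⟩, funext fun n => congrArg f (by ring)⟩

theorem bebutovShift_mem_iff (f : ℤ →ᵇ ℂ) (x : ℤ → ℂ) :
    x ∈ orbitClosure f ↔ bebutovShift x ∈ orbitClosure f := by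
  have h : bebutovShift '' orbitClosure f = orbitClosure f := by
    rw [orbitClosure, bebutovShift.image_closure, bebutovShift_image_orbit]
  rw [← bebutovShift.injective.mem_set_image (s := orbitClosure f), h]

/-- The shift restricted to `X_f`. -/
def orbitShift (f : ℤ →ᵇ ℂ) : orbitClosure f ≃ₜ orbitClosure f :=
  bebutovShift.subtype (bebutovShift_mem_iff f)

end WeylFlow

end

noncomputable section

open Filter Topology Polynomial CompactlySupported

namespace WeylFlow

/-! ### Invariant measures on compact spaces -/

set_option linter.unusedSectionVars false

section InvariantMeasure

variable {X : Type*} [TopologicalSpace X]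

/-! The Weyl algebra is the closed span of the phases e(p(n)) = e^{2πi p(n)}, p a real polynomial,
so a point of |W| is determined by its values on them (`gelfandSpace_ext`). Translation by m turns p
into p(X + m), which differs from p by a polynomial of smaller degree; this makes induction on the
degree possible.

Minimality: evaluation at 0 has a dense orbit (`dense_orbit_evalZero`), and induction on the degree
shows that the flow is distal (`gelfandShift_distal`). A distal flow with a dense orbit is minimal,
by an idempotent argument in the enveloping semigroup (`isMinimal_of_distal`).

Unique ergodicity: by Stone–Weierstrass it suffices that the integral of each phase is the same for
all invariant measures. Modulo rational polynomials, p is constant or has an irrational leading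
coefficient in positive degree. In the first case the phase is periodic and its integral is the mean
over a period. In the second the integral is 0 (`integral_weylPoly_eq_zero`): a linear phase is
handled by an eigenvalue argument, and in higher degree the translates of the phase are pairwise
orthogonal by induction and have equal integrals, so Bessel's inequality forces 0.

Finally φ ↦ (φ(T^n f))_n makes X_f a factor of |W|, and strict ergodicity passes to factors. -/

/-- The definition fixes the σ-algebra `borel X`; this form works with any `BorelSpace` instance. -/
theorem isUniquelyErgodic_iff [CompactSpace X] [T2Space X] [MeasurableSpace X] [BorelSpace X]
    (T : X ≃ₜ X) :
    IsUniquelyErgodic T ↔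
      ∃! μ : Measure X, IsProbabilityMeasure μ ∧ μ.Regular ∧ MeasurePreserving T μ μ := by
  have h := BorelSpace.measurable_eq (α := X)
  subst h
  rfl

variable [CompactSpace X] [T2Space X] [MeasurableSpace X] [BorelSpace X]

theorem integrable_of_continuous {E : Type*} [NormedAddCommGroup E]
    [SecondCountableTopologyEither X E] (μ : Measure X) [IsFiniteMeasure μ]
    {F : X → E} (hF : Continuous F) : Integrable F μ :=
  hF.integrable_of_hasCompactSupport (HasCompactSupport.of_compactSpace F)

theorem measure_ext_of_integral_eq {μ ν : Measure X} [IsFiniteMeasure μ] [IsFiniteMeasure ν]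
    [μ.Regular] [ν.Regular] (h : ∀ F : C(X, ℝ), ∫ x, F x ∂μ = ∫ x, F x ∂ν) : μ = ν :=
  Measure.ext_of_integral_eq_on_compactlySupported fun F => h F

/-- The **Riesz representation theorem** for states on a compact space. -/
theorem exists_measure_of_positive (Λ : C(X, ℝ) →ₗ[ℝ] ℝ) (hΛ : ∀ F, 0 ≤ F → 0 ≤ Λ F)
    (h1 : Λ 1 = 1) :
    ∃ μ : Measure X, IsProbabilityMeasure μ ∧ μ.Regular ∧ ∀ F : C(X, ℝ), ∫ x, F x ∂μ = Λ F := by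
  let Λ' : C_c(X, ℝ) →ₚ[ℝ] ℝ := PositiveLinearMap.mk₀
    { toFun := fun F => Λ F.toContinuousMap
      map_add' := fun F G => Λ.map_add F.toContinuousMap G.toContinuousMap
      map_smul' := fun c F => Λ.map_smul c F.toContinuousMap }
    fun F hF => hΛ _ hF
  have key : ∀ F : C(X, ℝ), ∫ x, F x ∂(RealRMK.rieszMeasure Λ') = Λ F := fun F =>
    RealRMK.integral_rieszMeasure Λ' (CompactlySupportedContinuousMap.continuousMapEquiv F)
  have hreg : (RealRMK.rieszMeasure Λ').Regular := inferInstance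
  refine ⟨RealRMK.rieszMeasure Λ', ⟨?_⟩, hreg, key⟩
  have h := key 1
  rw [h1] at h
  simp only [ContinuousMap.one_apply, integral_const, smul_eq_mul, mul_one, Measure.real] at h
  rwa [ENNReal.toReal_eq_one_iff] at h

/-- A regular measure is invariant as soon as its integrals of continuous functions are. -/
theorem measurePreserving_of_integral_comp (T : X ≃ₜ X) {μ : Measure X} [IsFiniteMeasure μ]
    [μ.Regular] (h : ∀ F : C(X, ℝ), ∫ x, F (T x) ∂μ = ∫ x, F x ∂μ) : MeasurePreserving T μ μ := by
  refine ⟨T.continuous.measurable, ?_⟩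
  have : (μ.map T).Regular := Measure.Regular.map T
  have : IsFiniteMeasure (μ.map T) := Measure.isFiniteMeasure_map μ T
  refine measure_ext_of_integral_eq fun F => ?_
  rw [integral_map T.continuous.aemeasurable F.continuous.aestronglyMeasurable]
  exact h F

theorem integral_comp_eq (T : X ≃ₜ X) {E : Type*} [NormedAddCommGroup E] [NormedSpace ℝ E]
    {μ : Measure X} (hT : MeasurePreserving T μ μ) (F : X → E) :
    ∫ x, F (T x) ∂μ = ∫ x, F x ∂μ :=
  hT.integral_comp T.measurableEmbedding F

theorem integral_birkhoffAverage (T : X ≃ₜ X) {μ : Measure X} [IsProbabilityMeasure μ]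
    (hT : MeasurePreserving T μ μ) (F : C(X, ℝ)) {n : ℕ} (hn : n ≠ 0) :
    ∫ x, birkhoffAverage ℝ T F n x ∂μ = ∫ x, F x ∂μ := by
  have hk : ∀ k : ℕ, ∫ x, F (T^[k] x) ∂μ = ∫ x, F x ∂μ := by
    intro k
    induction k with
    | zero => rfl
    | succ k ih =>
      rw [← ih, ← integral_comp_eq T hT fun x => F (T^[k] x)]
      simp only [Function.iterate_succ_apply]
  simp only [birkhoffAverage, birkhoffSum, smul_eq_mul]
  rw [integral_const_mul, integral_finsetSum _ fun k _ => (integrable_of_continuous μ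
    (F.continuous.comp (T.continuous.iterate k)) : Integrable (fun x => F (T^[k] x)) μ)]
  simp only [hk, Finset.sum_const, Finset.card_range, nsmul_eq_mul]
  field_simp

theorem abs_birkhoffAverage_le (T : X ≃ₜ X) (F : C(X, ℝ)) (n : ℕ) (x : X) :
    |birkhoffAverage ℝ T F n x| ≤ ‖F‖ := by
  rcases eq_or_ne n 0 with rfl | hn
  · simp
  have hn' : (0 : ℝ) < n := by positivity
  rw [birkhoffAverage, birkhoffSum, smul_eq_mul, abs_mul, abs_inv, abs_of_pos hn',
    inv_mul_le_iff₀ hn']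
  refine (Finset.abs_sum_le_sum_abs _ _).trans ((Finset.sum_le_sum fun k _ =>
    F.norm_coe_le_norm (T^[k] x)).trans_eq ?_)
  simp

/-- **Krylov–Bogoliubov**: ultrafilter limits of Birkhoff averages of increasing length, with
varying base points, are integrals against an invariant measure. -/
theorem exists_invariant_measure_tendsto (T : X ≃ₜ X) {ι : Type*} (U : Ultrafilter ι) (N : ι → ℕ)
    (hN : Tendsto N U atTop) (x : ι → X) :
    ∃ μ : Measure X, (IsProbabilityMeasure μ ∧ μ.Regular ∧ MeasurePreserving T μ μ) ∧
      ∀ F : C(X, ℝ), Tendsto (fun i => birkhoffAverage ℝ T F (N i) (x i)) U (𝓝 (∫ y, F y ∂μ)) := by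
  -- The averages stay in [-‖F‖, ‖F‖], so one ultrafilter gives limits for all F at once and no
  -- separability is needed.
  have hlim : ∀ F : C(X, ℝ), ∃ c, Tendsto (fun i => birkhoffAverage ℝ T F (N i) (x i)) U (𝓝 c) := by
    intro F
    obtain ⟨c, -, hc⟩ := (isCompact_Icc (a := -‖F‖) (b := ‖F‖)).ultrafilter_le_nhds
      (U.map fun i => birkhoffAverage ℝ T F (N i) (x i)) (tendsto_principal.2
        (Eventually.of_forall fun i => abs_le.1 (abs_birkhoffAverage_le T F _ _)))
    exact ⟨c, hc⟩
  choose L hL using hlim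
  let Λ : C(X, ℝ) →ₗ[ℝ] ℝ :=
    { toFun := L
      map_add' := fun F G => tendsto_nhds_unique (hL (F + G)) <| by
        refine ((hL F).add (hL G)).congr fun i => ?_
        rw [ContinuousMap.coe_add, birkhoffAverage_add]; rfl
      map_smul' := fun c F => tendsto_nhds_unique (hL (c • F)) <| by
        refine ((hL F).const_mul c).congr fun i => ?_
        simp only [birkhoffAverage, birkhoffSum, ContinuousMap.coe_smul, Pi.smul_apply, smul_eq_mul,
          ← Finset.mul_sum]
        ring }
  obtain ⟨μ, hμ, hreg, hΛ⟩ := exists_measure_of_positive Λ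
    (fun F hF => ge_of_tendsto' (hL F) fun i => by
      simp only [birkhoffAverage, birkhoffSum, smul_eq_mul]
      exact mul_nonneg (by positivity) (Finset.sum_nonneg fun k _ => hF _))
    (tendsto_nhds_unique (hL 1) <| by
      refine tendsto_const_nhds.congr' ?_
      filter_upwards [hN.eventually (eventually_ne_atTop 0)] with i hi
      have : (N i : ℝ) ≠ 0 := by exact_mod_cast hi
      simp [birkhoffAverage, birkhoffSum, this])
  refine ⟨μ, ⟨hμ, hreg, measurePreserving_of_integral_comp T fun F => ?_⟩, fun F => ?_⟩
  · have h1 := hΛ (F.comp ⟨T, T.continuous⟩)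
    have h2 := hΛ F
    simp only [ContinuousMap.comp_apply, ContinuousMap.coe_mk] at h1
    rw [h1, h2]
    have h3 := (hL (F.comp ⟨T, T.continuous⟩)).sub (hL F)
    have h4 : Tendsto (fun i => birkhoffAverage ℝ T (F.comp ⟨T, T.continuous⟩) (N i) (x i) -
        birkhoffAverage ℝ T F (N i) (x i)) U (𝓝 0) := by
      -- The averages from `x i` and from `T (x i)` differ only by the two end terms of the sum,
      -- hence by at most 2‖F‖/N.
      have h5 : Tendsto (fun i => 2 * ‖F‖ / (N i : ℝ)) U (𝓝 0) :=
        (tendsto_const_nhds.div_atTop tendsto_natCast_atTop_atTop).comp hN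
      refine squeeze_zero_norm (fun i => ?_) h5
      have h6 : birkhoffAverage ℝ T (F.comp ⟨T, T.continuous⟩) (N i) (x i) =
          birkhoffAverage ℝ T F (N i) (T (x i)) := by
        simp only [birkhoffAverage, birkhoffSum, ContinuousMap.comp_apply, ContinuousMap.coe_mk,
          ← Function.iterate_succ_apply, Function.iterate_succ_apply']
      rw [h6, ← dist_eq_norm, dist_birkhoffAverage_apply_birkhoffAverage]
      gcongr
      rw [dist_eq_norm, two_mul]
      exact (norm_sub_le _ _).trans (add_le_add (F.norm_coe_le_norm _) (F.norm_coe_le_norm _))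
    exact sub_eq_zero.1 (tendsto_nhds_unique h3 h4)
  · rw [hΛ F]
    exact hL F

theorem exists_invariant_measure [Nonempty X] (T : X ≃ₜ X) :
    ∃ μ : Measure X, IsProbabilityMeasure μ ∧ μ.Regular ∧ MeasurePreserving T μ μ := by
  obtain ⟨μ, hμ, -⟩ := exists_invariant_measure_tendsto T (Ultrafilter.of atTop) id
    (Ultrafilter.of_le atTop) fun _ => Classical.arbitrary X
  exact ⟨μ, hμ⟩

/-- In a uniquely ergodic flow the Birkhoff averages of a continuous function converge uniformly. -/
theorem tendstoUniformly_birkhoffAverage (T : X ≃ₜ X) {μ : Measure X}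
    (hμ : ∀ ν : Measure X, IsProbabilityMeasure ν ∧ ν.Regular ∧ MeasurePreserving T ν ν → ν = μ)
    (F : C(X, ℝ)) :
    TendstoUniformly (birkhoffAverage ℝ T F) (fun _ => ∫ y, F y ∂μ) atTop := by
  rw [Metric.tendstoUniformly_iff]
  by_contra! h
  obtain ⟨ε, hε, h⟩ := h
  rw [frequently_atTop] at h
  -- Failure of uniformity gives ever longer averages at distance at least ε from the integral.
  -- Their ultrafilter limit is an invariant measure, hence μ itself: a contradiction.
  choose N hN x hx using h
  obtain ⟨ν, hν, hlim⟩ := exists_invariant_measure_tendsto T (Ultrafilter.of atTop) N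
    ((tendsto_atTop_mono hN tendsto_id).mono_left (Ultrafilter.of_le atTop)) x
  have h1 := ((tendsto_const_nhds (x := ∫ y, F y ∂μ)).dist (hlim F))
  rw [hμ ν hν, dist_self] at h1
  exact absurd (ge_of_tendsto' h1 hx) (not_le.2 hε)

theorem integral_eq_of_tendstoUniformly (T : X ≃ₜ X) {μ : Measure X} [IsProbabilityMeasure μ]
    (hT : MeasurePreserving T μ μ) (F : C(X, ℝ)) {c : ℝ}
    (h : TendstoUniformly (birkhoffAverage ℝ T F) (fun _ => c) atTop) : ∫ y, F y ∂μ = c := by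
  refine eq_of_forall_dist_le fun ε hε => ?_
  -- The length 0 must be avoided: there the average is 0 by convention and its integral says
  -- nothing about F.
  obtain ⟨n, hn, hn0⟩ := ((Metric.tendstoUniformly_iff.1 h ε hε).and (eventually_ne_atTop 0)).exists
  rw [← integral_birkhoffAverage T hT F hn0, dist_comm, dist_eq_norm]
  have hc : Continuous (birkhoffAverage ℝ T F n) := by
    unfold birkhoffAverage birkhoffSum
    exact Continuous.const_smul (continuous_finsetSum _ fun k _ =>
      F.continuous.comp (T.continuous.iterate k)) (n : ℝ)⁻¹
  have h1 : c - ∫ x, birkhoffAverage ℝ T F n x ∂μ = ∫ x, (c - birkhoffAverage ℝ T F n x) ∂μ := by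
    rw [integral_sub (integrable_const _) (integrable_of_continuous μ hc)]
    simp
  rw [h1]
  refine (norm_integral_le_of_norm_le_const (C := ε) (Eventually.of_forall fun x => ?_)).trans ?_
  · exact (hn x).le
  · simp

end InvariantMeasure

/-! ### Factors -/

section Factor

variable {X Y : Type*} [TopologicalSpace X] [CompactSpace X] [T2Space X]
  [TopologicalSpace Y] [CompactSpace Y] [T2Space Y]

theorem semiconj_zpow {T : X ≃ₜ X} {S : Y ≃ₜ Y} {π : X → Y} (h : ∀ x, π (T x) = S (π x)) (n : ℤ)
    (x : X) : π ((T ^ n) x) = (S ^ n) (π x) := by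
  have hnat : ∀ (n : ℕ) x, π ((T ^ n) x) = (S ^ n) (π x) := by
    intro n
    induction n with
    | zero => intro x; rfl
    | succ n ih =>
      intro x
      rw [pow_succ, pow_succ]
      exact (ih (T x)).trans (congrArg (S ^ n) (h x))
  cases n with
  | ofNat n => simpa using hnat n x
  | negSucc n =>
    rw [zpow_negSucc, zpow_negSucc]
    have h1 := hnat (n + 1) ((T ^ (n + 1))⁻¹ x)
    have h2 : (T ^ (n + 1)) ((T ^ (n + 1))⁻¹ x) = x := (T ^ (n + 1)).apply_symm_apply x
    rw [h2] at h1
    rw [h1]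
    exact ((S ^ (n + 1)).symm_apply_apply _).symm

theorem IsMinimal.factor {T : X ≃ₜ X} {S : Y ≃ₜ Y} (hT : IsMinimal T) {π : X → Y}
    (hπ : Continuous π) (hs : Function.Surjective π) (h : ∀ x, π (T x) = S (π x)) :
    IsMinimal S := by
  intro y
  obtain ⟨x, rfl⟩ := hs y
  have := hs.denseRange.dense_image hπ (hT x)
  rw [← Set.range_comp] at this
  convert this using 2
  exact funext fun n => (semiconj_zpow h n x).symm

/-- No measure is lifted from Y to X. Uniform convergence of Birkhoff averages to a constant
descends along a surjection, and it determines the integral against every invariant measure on Y. -/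
theorem IsUniquelyErgodic.factor {T : X ≃ₜ X} {S : Y ≃ₜ Y} (hT : IsUniquelyErgodic T)
    [Nonempty Y] {π : X → Y} (hπ : Continuous π) (hs : Function.Surjective π)
    (h : ∀ x, π (T x) = S (π x)) : IsUniquelyErgodic S := by
  let : MeasurableSpace X := borel X
  let : MeasurableSpace Y := borel Y
  have : BorelSpace X := ⟨rfl⟩
  have : BorelSpace Y := ⟨rfl⟩
  rw [isUniquelyErgodic_iff] at hT ⊢
  obtain ⟨μ, -, huniq⟩ := hT
  obtain ⟨ν, hν⟩ := exists_invariant_measure S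
  have hit : ∀ (k : ℕ) x, π (T^[k] x) = S^[k] (π x) := fun k x =>
    (Function.Semiconj.iterate_right (f := π) (ga := T) (gb := S) h k) x
  have key : ∀ F : C(Y, ℝ), TendstoUniformly (birkhoffAverage ℝ S F)
      (fun _ => ∫ x, F (π x) ∂μ) atTop := by
    intro F
    have h1 := tendstoUniformly_birkhoffAverage T huniq (F.comp ⟨π, hπ⟩)
    rw [Metric.tendstoUniformly_iff] at h1 ⊢
    intro ε hε
    filter_upwards [h1 ε hε] with n hn y
    obtain ⟨x, rfl⟩ := hs y
    simpa [birkhoffAverage, birkhoffSum, hit] using hn x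
  refine ⟨ν, hν, fun ν' hν' => ?_⟩
  obtain ⟨_, _, hS⟩ := hν
  obtain ⟨_, _, hS'⟩ := hν'
  refine measure_ext_of_integral_eq fun F => ?_
  rw [integral_eq_of_tendstoUniformly S hS F (key F),
    integral_eq_of_tendstoUniformly S hS' F (key F)]

theorem IsStrictlyErgodic.factor {T : X ≃ₜ X} {S : Y ≃ₜ Y} (hT : IsStrictlyErgodic T)
    [Nonempty Y] {π : X → Y} (hπ : Continuous π) (hs : Function.Surjective π)
    (h : ∀ x, π (T x) = S (π x)) : IsStrictlyErgodic S :=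
  ⟨hT.1.factor hπ hs h, hT.2.factor hπ hs h⟩

end Factor

/-! ### Approximation and orthogonality -/

section Approximation

variable {X : Type*} [TopologicalSpace X] [CompactSpace X]

/-- **Stone–Weierstrass** for the linear span of a monoid of functions. -/
theorem exists_mem_span_approx {M : Submonoid C(X, ℂ)} (hstar : ∀ F ∈ M, star F ∈ M)
    (hsep : ∀ x y : X, x ≠ y → ∃ F ∈ M, F x ≠ F y) (F : C(X, ℂ)) {ε : ℝ} (hε : 0 < ε) :
    ∃ G ∈ Submodule.span ℂ (M : Set C(X, ℂ)), ∀ x, ‖F x - G x‖ < ε := by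
  have hS := ContinuousMap.starSubalgebra_topologicalClosure_eq_top_of_separatesPoints
    (StarAlgebra.adjoin ℂ (M : Set C(X, ℂ))) (by
      intro x y hne
      obtain ⟨F, hF, hxy⟩ := hsep x y hne
      exact ⟨F, ⟨F, StarAlgebra.subset_adjoin ℂ _ hF, rfl⟩, hxy⟩)
  -- Since `M` is closed under products and `star`, the star algebra it generates consists of linear
  -- combinations of its elements.
  have hle : ∀ F ∈ StarAlgebra.adjoin ℂ (M : Set C(X, ℂ)),
      F ∈ Submodule.span ℂ (M : Set C(X, ℂ)) := by
    intro F hF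
    have h1 : F ∈ Subalgebra.toSubmodule (StarAlgebra.adjoin ℂ (M : Set C(X, ℂ))).toSubalgebra :=
      hF
    rw [StarAlgebra.adjoin_eq_span] at h1
    refine Submodule.span_mono ?_ h1
    have : Submonoid.closure ((M : Set C(X, ℂ)) ∪ star (M : Set C(X, ℂ))) ≤ M := by
      refine Submonoid.closure_le.2 (Set.union_subset le_rfl fun F hF => ?_)
      have := hstar _ hF
      rwa [star_star] at this
    exact this
  have h2 : F ∈ (StarAlgebra.adjoin ℂ (M : Set C(X, ℂ))).topologicalClosure := hS ▸ trivial
  obtain ⟨G, hG, hd⟩ := Metric.mem_closure_iff.1 h2 ε hε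
  refine ⟨G, hle G hG, fun x => ?_⟩
  rw [← dist_eq_norm]
  exact (ContinuousMap.dist_apply_le_dist x).trans_lt hd

variable [T2Space X] [MeasurableSpace X] [BorelSpace X]

/-- Integration against a probability measure is linear and 1-Lipschitz in the sup norm, so
agreement on `M` spreads to its span and then to the uniform closure. -/
theorem measure_ext_of_integral_eq_of_separates {M : Submonoid C(X, ℂ)}
    (hstar : ∀ F ∈ M, star F ∈ M) (hsep : ∀ x y : X, x ≠ y → ∃ F ∈ M, F x ≠ F y)
    {μ ν : Measure X} [IsProbabilityMeasure μ] [IsProbabilityMeasure ν] [μ.Regular] [ν.Regular]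
    (h : ∀ F ∈ M, ∫ x, F x ∂μ = ∫ x, F x ∂ν) : μ = ν := by
  have hint : ∀ (ρ : Measure X) [IsProbabilityMeasure ρ] (F : C(X, ℂ)), Integrable F ρ :=
    fun ρ _ F => integrable_of_continuous ρ F.continuous
  have hspan : ∀ G ∈ Submodule.span ℂ (M : Set C(X, ℂ)), ∫ x, G x ∂μ = ∫ x, G x ∂ν := by
    intro G hG
    induction hG using Submodule.span_induction with
    | mem G hG => exact h G hG
    | zero => simp
    | add F G _ _ hF hG =>
      simp only [ContinuousMap.add_apply]
      rw [integral_add (hint μ F) (hint μ G), integral_add (hint ν F) (hint ν G), hF, hG]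
    | smul c F _ hF =>
      simp only [ContinuousMap.smul_apply, integral_smul, hF]
  have happrox : ∀ (ρ : Measure X) [IsProbabilityMeasure ρ] (F G : C(X, ℂ)) (ε : ℝ),
      (∀ x, ‖F x - G x‖ < ε) → ‖∫ x, F x ∂ρ - ∫ x, G x ∂ρ‖ ≤ ε := by
    intro ρ _ F G ε hFG
    rw [← integral_sub (hint ρ F) (hint ρ G)]
    refine (norm_integral_le_of_norm_le_const (Eventually.of_forall fun x => (hFG x).le)).trans ?_
    simp
  have hall : ∀ F : C(X, ℂ), ∫ x, F x ∂μ = ∫ x, F x ∂ν := by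
    intro F
    refine eq_of_forall_dist_le fun ε hε => ?_
    obtain ⟨G, hG, hFG⟩ := exists_mem_span_approx hstar hsep F (half_pos hε)
    have h1 := happrox μ F G _ hFG
    have h2 := happrox ν F G _ hFG
    rw [← dist_eq_norm] at h1 h2
    rw [hspan G hG] at h1
    linarith [dist_triangle_right (∫ x, F x ∂μ) (∫ x, F x ∂ν) (∫ x, G x ∂ν)]
  refine measure_ext_of_integral_eq fun F => ?_
  have h1 := hall ⟨fun x => (F x : ℂ), Complex.continuous_ofReal.comp F.continuous⟩
  simp only [ContinuousMap.coe_mk, integral_complex_ofReal] at h1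
  exact_mod_cast h1

/-- A constant sequence of integrals of pairwise orthogonal unimodular functions vanishes. -/
theorem eq_zero_of_integral_eq_of_orthogonal (μ : Measure X) [IsProbabilityMeasure μ]
    (f : ℕ → C(X, ℂ)) (hf : ∀ n x, ‖f n x‖ = 1)
    (ho : ∀ i j, i < j → ∫ x, f j x * (starRingEnd ℂ) (f i x) ∂μ = 0) {c : ℂ}
    (hc : ∀ n, ∫ x, f n x ∂μ = c) : c = 0 := by
  let v : ℕ → Lp ℂ 2 μ := fun n => ContinuousMap.toLp 2 μ ℂ (f n)
  have hv : Orthonormal ℂ v := by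
    rw [orthonormal_iff_ite]
    intro i j
    split_ifs with hij
    · subst hij
      rw [ContinuousMap.inner_toLp]
      simp [Complex.mul_conj, Complex.normSq_eq_norm_sq, hf]
    · rcases lt_or_gt_of_ne hij with hij | hij
      · rw [ContinuousMap.inner_toLp]
        exact ho i j hij
      · rw [inner_eq_zero_symm, ContinuousMap.inner_toLp]
        exact ho j i hij
  -- Bessel's inequality for the constant function 1: the coefficients all have modulus ‖c‖ and are
  -- square summable.
  have h1 := hv.inner_products_summable (x := ContinuousMap.toLp 2 μ ℂ 1)
  have h2 : ∀ n, ‖inner ℂ (v n) (ContinuousMap.toLp 2 μ ℂ 1)‖ ^ 2 = ‖c‖ ^ 2 := fun n => by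
    rw [ContinuousMap.inner_toLp]
    simp only [ContinuousMap.one_apply, one_mul]
    rw [integral_conj, hc, RCLike.norm_conj]
  rw [summable_congr h2, summable_const_iff] at h1
  simpa using h1

end Approximation

/-! ### Distal flows -/

section Distal

variable {X : Type*} [TopologicalSpace X] [CompactSpace X] [T2Space X]

/-- **Ellis**: a distal flow with a dense orbit is minimal. Distality is phrased with limits along
ultrafilters on `ℤ`. -/
theorem isMinimal_of_distal (T : X ≃ₜ X)
    (hd : ∀ (U : Ultrafilter ℤ) (x y z : X), Tendsto (fun n : ℤ => (T ^ n) x) U (𝓝 z) →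
      Tendsto (fun n : ℤ => (T ^ n) y) U (𝓝 z) → x = y)
    {x₀ : X} (hx₀ : Dense (Set.range fun n : ℤ => (T ^ n) x₀)) : IsMinimal T := by
  intro y
  -- The product is composition and the topology is pointwise convergence. Right multiplication is
  -- continuous, left multiplication only by continuous maps such as `τ n`; the closure `E` of the
  -- powers of T is the enveloping semigroup.
  let : TopologicalSpace (Function.End X) := inferInstanceAs (TopologicalSpace (X → X))
  have : T2Space (Function.End X) := inferInstanceAs (T2Space (X → X))
  have : CompactSpace (Function.End X) := inferInstanceAs (CompactSpace (X → X))
  let τ : ℤ → Function.End X := fun n => ⇑(T ^ n)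
  have hτ : ∀ m n, τ m * τ n = τ (m + n) := fun m n => by
    funext z
    exact (congrArg (fun g : X ≃ₜ X => g z) (zpow_add T m n)).symm
  have hright : ∀ r : Function.End X, Continuous fun p : Function.End X => p * r := fun r =>
    continuous_pi fun z => continuous_apply (r z)
  have hleft : ∀ n, Continuous fun p : Function.End X => τ n * p := fun n =>
    continuous_pi fun z => (T ^ n).continuous.comp (continuous_apply z)
  let E : Set (Function.End X) := closure (Set.range τ)
  have hEc : IsCompact E := isClosed_closure.isCompact
  have hE1 : ∀ n, ∀ q ∈ E, τ n * q ∈ E := fun n q hq => by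
    refine map_mem_closure (hleft n) hq ?_
    rintro _ ⟨m, rfl⟩
    exact ⟨n + m, (hτ n m).symm⟩
  have hE : ∀ p ∈ E, ∀ q ∈ E, p * q ∈ E := fun p hp q hq => by
    have := map_mem_closure (t := E) (hright q) hp (by rintro _ ⟨n, rfl⟩; exact hE1 n q hq)
    rwa [isClosed_closure.closure_eq] at this
  have hlim : ∀ p ∈ E, ∃ U : Ultrafilter ℤ, ∀ z, Tendsto (fun n : ℤ => (T ^ n) z) U (𝓝 (p z)) := by
    intro p hp
    have : (comap τ (𝓝 p)).NeBot := comap_neBot_iff_frequently.2 (mem_closure_iff_frequently.1 hp)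
    exact ⟨Ultrafilter.of (comap τ (𝓝 p)), fun z => ((continuous_apply z).tendsto p).comp
      (tendsto_comap.mono_left (Ultrafilter.of_le _))⟩
  obtain ⟨q, hq, hqy⟩ : ∃ q ∈ E, q x₀ = y := by
    have h1 : IsClosed ((fun p : Function.End X => p x₀) '' E) :=
      (hEc.image (continuous_apply x₀)).isClosed
    have h2 : (Set.range fun n : ℤ => (T ^ n) x₀) ⊆ (fun p : Function.End X => p x₀) '' E := by
      rintro _ ⟨n, rfl⟩
      exact ⟨τ n, subset_closure ⟨n, rfl⟩, rfl⟩
    exact closure_minimal h2 h1 (hx₀ y)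
  -- The idempotent is sought in the left ideal `E * q`, so that u = p q sends x₀ to p y.
  obtain ⟨u, ⟨p, hp, rfl⟩, hu⟩ := exists_idempotent_in_compact_subsemigroup hright
    ((fun p => p * q) '' E) ⟨_, q, hq, rfl⟩ (hEc.image (hright q)) (by
      rintro _ ⟨p, hp, rfl⟩ _ ⟨p', hp', rfl⟩
      exact ⟨p * q * p', hE _ (hE p hp q hq) _ hp', mul_assoc _ _ _⟩)
  obtain ⟨U, hU⟩ := hlim _ (hE p hp q hq)
  -- Idempotence gives u(u x₀) = u x₀: the points u x₀ and x₀ have the same limit along U, so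
  -- distality makes them equal.
  have hfix : p y = x₀ := by
    have h1 : (p * q) ((p * q) x₀) = (p * q) x₀ := congrFun hu x₀
    have h2 := hd U _ _ _ (hU ((p * q) x₀)) (h1 ▸ hU x₀)
    rw [← hqy]
    exact h2
  have hmem : x₀ ∈ closure (Set.range fun n : ℤ => (T ^ n) y) := by
    rw [← hfix]
    refine map_mem_closure (f := fun p : Function.End X => p y) (continuous_apply y) hp ?_
    rintro _ ⟨n, rfl⟩
    exact ⟨n, rfl⟩
  have hsub : (Set.range fun n : ℤ => (T ^ n) x₀) ⊆ closure (Set.range fun n : ℤ => (T ^ n) y) := by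
    rintro _ ⟨n, rfl⟩
    refine map_mem_closure (T ^ n).continuous hmem ?_
    rintro _ ⟨m, rfl⟩
    exact ⟨n + m, congrFun (hτ n m).symm y⟩
  exact fun z => closure_minimal hsub isClosed_closure (hx₀ z)

end Distal

/-! ### Polynomial phases -/

/-- The polynomial phase `n ↦ e^{2 π i p(n)}`. -/
def polyFun (p : ℝ[X]) : ℤ →ᵇ ℂ :=
  BoundedContinuousFunction.ofNormedAddCommGroupDiscrete
    (fun n : ℤ => (Real.fourierChar (p.eval (n : ℝ)) : ℂ)) 1 fun _ => (Circle.norm_coe _).le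

theorem polyFun_apply (p : ℝ[X]) (n : ℤ) :
    polyFun p n = (Real.fourierChar (p.eval (n : ℝ)) : ℂ) := rfl

theorem polyFun_zero : polyFun 0 = 1 := by
  ext n
  simp [polyFun_apply]

theorem polyFun_add (p q : ℝ[X]) : polyFun (p + q) = polyFun p * polyFun q := by
  ext n
  simp [polyFun_apply, AddChar.map_add_eq_mul]

theorem polyFun_monomial (k : ℕ) (α : ℝ) : polyFun (monomial k α) = weylFun α k := by
  ext n
  simp only [polyFun_apply, Real.fourierChar_apply, eval_monomial, weylFun,
    BoundedContinuousFunction.coe_ofNormedAddCommGroupDiscrete]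
  push_cast
  ring_nf

theorem norm_polyFun_le (p : ℝ[X]) : ‖polyFun p‖ ≤ 1 :=
  (BoundedContinuousFunction.norm_le zero_le_one).2 fun _ => (Circle.norm_coe _).le

theorem translate_polyFun (m : ℤ) (p : ℝ[X]) :
    translate m (polyFun p) = polyFun (taylor (m : ℝ) p) := by
  ext n
  simp [polyFun_apply, taylor_eval]

theorem polyFun_mem (p : ℝ[X]) : polyFun p ∈ weylAlgebra := by
  induction p using Polynomial.induction_on' with
  | add p q hp hq => rw [polyFun_add]; exact mul_mem hp hq
  | monomial k α =>
    rw [polyFun_monomial, weylAlgebra, Algebra.mem_sInf]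
    exact fun S hS => hS.2.2 α k

/-- A polynomial phase, as an element of the Weyl algebra. -/
def weylPoly (p : ℝ[X]) : weylAlgebra := ⟨polyFun p, polyFun_mem p⟩

theorem weylPoly_zero : weylPoly 0 = 1 := Subtype.ext polyFun_zero

theorem weylPoly_add (p q : ℝ[X]) : weylPoly (p + q) = weylPoly p * weylPoly q :=
  Subtype.ext (polyFun_add p q)

theorem weylTranslate_weylPoly (m : ℤ) (p : ℝ[X]) :
    weylTranslate m (weylPoly p) = weylPoly (taylor (m : ℝ) p) :=
  Subtype.ext (translate_polyFun m p)

/-- Polynomial phases are permuted by translation, so the closed algebra they generate is itself one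
of the algebras over which the infimum is taken. -/
theorem weylAlgebra_le : weylAlgebra ≤ (Algebra.adjoin ℂ (Set.range polyFun)).topologicalClosure := by
  refine sInf_le ⟨Subalgebra.isClosed_topologicalClosure _, fun f hf m => ?_, fun α k => ?_⟩
  · have hc : Continuous (translate m) := BoundedContinuousFunction.continuous_compContinuous _
    have h1 : Algebra.adjoin ℂ (Set.range polyFun) ≤
        (Algebra.adjoin ℂ (Set.range polyFun)).comap (translate m) := by
      refine Algebra.adjoin_le ?_
      rintro _ ⟨p, rfl⟩
      change translate m (polyFun p) ∈ Algebra.adjoin ℂ (Set.range polyFun)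
      rw [translate_polyFun]
      exact Algebra.subset_adjoin ⟨_, rfl⟩
    exact map_mem_closure (t := (Algebra.adjoin ℂ (Set.range polyFun) : Set (ℤ →ᵇ ℂ))) hc hf
      fun g hg => h1 hg
  · rw [← polyFun_monomial]
    exact Subalgebra.le_topologicalClosure _ (Algebra.subset_adjoin ⟨_, rfl⟩)

/-- A closed subalgebra of the Weyl algebra that contains the polynomial phases is everything. -/
theorem eq_top_of_isClosed_of_weylPoly_mem {A : Subalgebra ℂ weylAlgebra}
    (hA : IsClosed (A : Set weylAlgebra)) (h : ∀ p, weylPoly p ∈ A) : A = ⊤ := by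
  refine eq_top_iff.2 fun f _ => ?_
  have hcl : IsClosed ((A.map weylAlgebra.val : Subalgebra ℂ (ℤ →ᵇ ℂ)) : Set (ℤ →ᵇ ℂ)) := by
    rw [Subalgebra.coe_map]
    exact isClosed_weylAlgebra.isClosedEmbedding_subtypeVal.isClosedMap _ hA
  have h1 : (Algebra.adjoin ℂ (Set.range polyFun)).topologicalClosure ≤ A.map weylAlgebra.val := by
    refine Subalgebra.topologicalClosure_minimal (Algebra.adjoin_le ?_) hcl
    rintro _ ⟨p, rfl⟩
    exact ⟨weylPoly p, h p, rfl⟩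
  obtain ⟨g, hg, hgf⟩ := h1 (weylAlgebra_le f.2)
  rwa [← Subtype.ext (hgf : (g : ℤ →ᵇ ℂ) = f)]

/-- The set where two characters agree is a closed subalgebra. -/
theorem gelfandSpace_ext {φ ψ : GelfandSpace} (h : ∀ p, φ (weylPoly p) = ψ (weylPoly p)) :
    φ = ψ := by
  have h1 := eq_top_of_isClosed_of_weylPoly_mem
    (A := AlgHom.equalizer (CharacterSpace.toAlgHom φ) (CharacterSpace.toAlgHom ψ))
    (isClosed_eq (map_continuous φ) (map_continuous ψ)) h
  refine CharacterSpace.ext fun f => ?_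
  have h2 : f ∈ AlgHom.equalizer (CharacterSpace.toAlgHom φ) (CharacterSpace.toAlgHom ψ) :=
    h1 ▸ Algebra.mem_top
  exact h2

instance : NormOneClass weylAlgebra := ⟨norm_one (α := ℤ →ᵇ ℂ)⟩

instance : CompactSpace GelfandSpace := CharacterSpace.instCompactSpaceElemCharacterSpaceOfProperSpace

theorem norm_character_le (φ : GelfandSpace) (f : weylAlgebra) : ‖φ f‖ ≤ ‖f‖ :=
  AlgHom.norm_apply_le_self φ f

theorem character_mul_neg (φ : GelfandSpace) (p : ℝ[X]) :
    φ (weylPoly p) * φ (weylPoly (-p)) = 1 := by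
  rw [← map_mul, ← weylPoly_add, add_neg_cancel, weylPoly_zero, map_one]

/-- The values at p and -p have modulus at most 1 and product 1. -/
theorem norm_character_weylPoly (φ : GelfandSpace) (p : ℝ[X]) : ‖φ (weylPoly p)‖ = 1 := by
  have h1 := (norm_character_le φ (weylPoly p)).trans (norm_polyFun_le p)
  have h2 := (norm_character_le φ (weylPoly (-p))).trans (norm_polyFun_le (-p))
  have h3 := congrArg norm (character_mul_neg φ p)
  rw [norm_mul, norm_one] at h3
  nlinarith [norm_nonneg (φ (weylPoly p)), norm_nonneg (φ (weylPoly (-p)))]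

theorem conj_character_weylPoly (φ : GelfandSpace) (p : ℝ[X]) :
    (starRingEnd ℂ) (φ (weylPoly p)) = φ (weylPoly (-p)) := by
  rw [← Complex.inv_eq_conj (norm_character_weylPoly φ p)]
  exact inv_eq_of_mul_eq_one_right (character_mul_neg φ p)

/-- The Gelfand transform of a polynomial phase. -/
def hatPoly (p : ℝ[X]) : C(GelfandSpace, ℂ) := gelfandTransform ℂ weylAlgebra (weylPoly p)

theorem hatPoly_apply (p : ℝ[X]) (φ : GelfandSpace) : hatPoly p φ = φ (weylPoly p) := rfl

/-- The Gelfand transforms of the polynomial phases, as a multiplicative monoid. -/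
def hatPolyMonoid : Submonoid C(GelfandSpace, ℂ) where
  carrier := Set.range hatPoly
  one_mem' := ⟨0, by ext φ; simp [hatPoly_apply, weylPoly_zero]⟩
  mul_mem' := by
    rintro _ _ ⟨p, rfl⟩ ⟨q, rfl⟩
    exact ⟨p + q, by ext φ; simp [hatPoly_apply, weylPoly_add]⟩

theorem star_mem_hatPolyMonoid : ∀ F ∈ hatPolyMonoid, star F ∈ hatPolyMonoid := by
  rintro _ ⟨p, rfl⟩
  refine ⟨-p, ?_⟩
  ext φ
  exact (conj_character_weylPoly φ p).symm

theorem hatPolyMonoid_separates (φ ψ : GelfandSpace) (hne : φ ≠ ψ) :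
    ∃ F ∈ hatPolyMonoid, F φ ≠ F ψ := by
  by_contra! h
  exact hne (gelfandSpace_ext fun p => h (hatPoly p) ⟨p, rfl⟩)

/-! ### Minimality of the Gelfand flow -/

theorem gelfandShift_zpow (n : ℤ) (φ : GelfandSpace) :
    (gelfandShift ^ n) φ = gelfandTranslate n φ := by
  have hadd : ∀ (m n : ℤ) (φ : GelfandSpace),
      gelfandTranslate m (gelfandTranslate n φ) = gelfandTranslate (m + n) φ := by
    intro m n φ
    refine CharacterSpace.ext fun f => congrArg φ (Subtype.ext ?_)
    ext k
    exact congrArg (f : ℤ →ᵇ ℂ) (by ring : k + n + m = k + (m + n))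
  induction n using Int.induction_on generalizing φ with
  | zero =>
    refine CharacterSpace.ext fun f => congrArg φ (Subtype.ext ?_)
    ext k
    exact congrArg (f : ℤ →ᵇ ℂ) (by ring : k = k + 0)
  | succ n ih =>
    rw [zpow_add_one]
    exact (ih (gelfandTranslate 1 φ)).trans (hadd _ _ _)
  | pred n ih =>
    rw [zpow_sub_one]
    exact (ih (gelfandTranslate (-1) φ)).trans (hadd _ _ _)

theorem gelfandShift_zpow_weylPoly (n : ℤ) (φ : GelfandSpace) (p : ℝ[X]) :
    (gelfandShift ^ n) φ (weylPoly p) = φ (weylPoly (taylor (n : ℝ) p)) := by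
  rw [gelfandShift_zpow, gelfandTranslate_apply, weylTranslate_weylPoly]

/-- The evaluation at `0`, as a point of the Gelfand space. -/
def evalZero : GelfandSpace :=
  CharacterSpace.equivAlgHom.symm
    ({ toFun := fun f => (f : ℤ →ᵇ ℂ) 0
       map_one' := rfl
       map_mul' := fun _ _ => rfl
       map_zero' := rfl
       map_add' := fun _ _ => rfl
       commutes' := fun _ => rfl } : weylAlgebra →ₐ[ℂ] ℂ)

theorem evalZero_apply (f : weylAlgebra) : evalZero f = (f : ℤ →ᵇ ℂ) 0 := rfl

theorem gelfandShift_zpow_evalZero (n : ℤ) (f : weylAlgebra) :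
    (gelfandShift ^ n) evalZero f = (f : ℤ →ᵇ ℂ) n := by
  rw [gelfandShift_zpow, gelfandTranslate_apply, evalZero_apply]
  exact congrArg (f : ℤ →ᵇ ℂ) (zero_add n)

/-- The orbit consists of the evaluations at integers, so an element of the algebra that is small on
the orbit is small in norm, and then small at every character. A Urysohn function, approximated by a
Gelfand transform, would violate this at a point off the closure. -/
theorem dense_orbit_evalZero : Dense (Set.range fun n : ℤ => (gelfandShift ^ n) evalZero) := by
  intro φ
  by_contra hφ
  obtain ⟨F, hF0, hF1, -⟩ := exists_continuous_zero_one_of_isClosed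
    (isClosed_closure (s := Set.range fun n : ℤ => (gelfandShift ^ n) evalZero))
    (isClosed_singleton (x := φ)) (Set.disjoint_singleton_right.2 hφ)
  let G : C(GelfandSpace, ℂ) := ⟨fun ψ => (F ψ : ℂ), Complex.continuous_ofReal.comp F.continuous⟩
  obtain ⟨H, hH, hGH⟩ := exists_mem_span_approx star_mem_hatPolyMonoid hatPolyMonoid_separates G
    -- Any bound up to 1/2 would do: the contradiction is 1 ≤ ‖1 - φ f‖ + ‖φ f‖ < 2/3.
    (show (0 : ℝ) < 1 / 3 by norm_num)
  have hle : Submodule.span ℂ (hatPolyMonoid : Set C(GelfandSpace, ℂ)) ≤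
      LinearMap.range (gelfandTransform ℂ weylAlgebra).toLinearMap := by
    refine Submodule.span_le.2 ?_
    rintro _ ⟨p, rfl⟩
    exact ⟨weylPoly p, rfl⟩
  obtain ⟨f, rfl⟩ := hle hH
  have hd : ∀ ψ : GelfandSpace, ‖(F ψ : ℂ) - ψ f‖ < 1 / 3 := hGH
  have h1 : ‖f‖ ≤ 1 / 3 := by
    refine (BoundedContinuousFunction.norm_le (by norm_num)).2 fun n => ?_
    have h2 := hd ((gelfandShift ^ n) evalZero)
    rw [hF0 (subset_closure ⟨n, rfl⟩), gelfandShift_zpow_evalZero] at h2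
    simpa using h2.le
  have h3 := hd φ
  rw [hF1 rfl] at h3
  have h4 := (norm_character_le φ f).trans h1
  have h5 : ‖(1 : ℂ)‖ ≤ ‖(1 : ℂ) - φ f‖ + ‖φ f‖ := by
    simpa using norm_add_le ((1 : ℂ) - φ f) (φ f)
  rw [norm_one] at h5
  simp only [Pi.one_apply, Complex.ofReal_one] at h3
  linarith

theorem degree_taylor_sub_lt (c : ℝ) {p : ℝ[X]} (hp : p ≠ 0) : (taylor c p - p).degree < p.degree := by
  rw [← degree_taylor p c]
  exact degree_sub_lt_left (degree_taylor p c) (by simpa using hp) (leadingCoeff_taylor c p)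

/-- The value of T^n w at p is w(p) times w at p(X + n) - p, which has smaller degree. If x and y
agree in smaller degrees, the ratio of T^n y to T^n x at p is the constant y(p)/x(p); the common
nonzero limit z(p) forces it to be 1. -/
theorem gelfandShift_distal (U : Ultrafilter ℤ) (x y z : GelfandSpace)
    (hx : Tendsto (fun n : ℤ => (gelfandShift ^ n) x) U (𝓝 z))
    (hy : Tendsto (fun n : ℤ => (gelfandShift ^ n) y) U (𝓝 z)) : x = y := by
  -- With the strict bound, d = 0 leaves only p = 0; nonzero constants already belong to the
  -- inductive step.
  have main : ∀ (d : ℕ) (p : ℝ[X]), p.degree < d → x (weylPoly p) = y (weylPoly p) := by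
    intro d
    induction d with
    | zero =>
      intro p hp
      have : p = 0 := by simpa using hp
      rw [this, weylPoly_zero, map_one, map_one]
    | succ d ih =>
      intro p hp
      rcases eq_or_ne p 0 with rfl | hp0
      · rw [weylPoly_zero, map_one, map_one]
      have hsplit : ∀ (w : GelfandSpace) (n : ℤ), (gelfandShift ^ n) w (weylPoly p) =
          w (weylPoly p) * w (weylPoly (taylor (n : ℝ) p - p)) := fun w n => by
        rw [gelfandShift_zpow_weylPoly, ← map_mul, ← weylPoly_add, add_sub_cancel]
      have hc : Continuous fun w : GelfandSpace => w (weylPoly p) := (hatPoly p).continuous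
      have hx' := (hc.tendsto z).comp hx
      have hy' := (hc.tendsto z).comp hy
      have hx0 : x (weylPoly p) ≠ 0 := norm_ne_zero_iff.1 (by simp [norm_character_weylPoly])
      have hz0 : z (weylPoly p) ≠ 0 := norm_ne_zero_iff.1 (by simp [norm_character_weylPoly])
      have h1 := hx'.const_mul (y (weylPoly p) / x (weylPoly p))
      have h2 : ∀ n : ℤ, y (weylPoly p) / x (weylPoly p) * (gelfandShift ^ n) x (weylPoly p) =
          (gelfandShift ^ n) y (weylPoly p) := fun n => by
        have hlt : (taylor (n : ℝ) p - p).degree < d :=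
          (degree_taylor_sub_lt _ hp0).trans_le (Order.lt_succ_iff.1 (by exact_mod_cast hp))
        rw [hsplit, hsplit, ih _ hlt]
        field_simp
      have h3 := tendsto_nhds_unique (h1.congr h2) hy'
      rw [mul_eq_right₀ hz0, div_eq_one_iff_eq hx0] at h3
      exact h3.symm
  exact gelfandSpace_ext fun p => main (p.natDegree + 1) p
    (degree_le_natDegree.trans_lt (by exact_mod_cast Nat.lt_succ_self _))

theorem isMinimal_gelfandShift : IsMinimal gelfandShift :=
  isMinimal_of_distal gelfandShift gelfandShift_distal dense_orbit_evalZero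

/-! ### Orbit closures as factors -/

/-- The factor map from the Gelfand space to the orbit closure of a function. -/
def toOrbitClosure (f : weylAlgebra) (φ : GelfandSpace) : orbitClosure (f : ℤ →ᵇ ℂ) :=
  ⟨fun n => φ (weylTranslate n f), by
    have hc : Continuous fun (φ : GelfandSpace) (n : ℤ) => φ (weylTranslate n f) :=
      continuous_pi fun n => (gelfandTransform ℂ weylAlgebra (weylTranslate n f)).continuous
    refine map_mem_closure hc (dense_orbit_evalZero φ) ?_
    rintro _ ⟨m, rfl⟩
    refine ⟨m, funext fun n => ?_⟩
    refine Eq.symm ((gelfandShift_zpow_evalZero m (weylTranslate n f)).trans ?_)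
    exact congrArg (f : ℤ →ᵇ ℂ) (add_comm m n)⟩

theorem continuous_toOrbitClosure (f : weylAlgebra) : Continuous (toOrbitClosure f) :=
  (continuous_pi fun n =>
    (gelfandTransform ℂ weylAlgebra (weylTranslate n f)).continuous).subtype_mk _

/-- The image is compact, hence closed, and contains the orbit of f as the image of the orbit of
`evalZero`. -/
theorem surjective_toOrbitClosure (f : weylAlgebra) : Function.Surjective (toOrbitClosure f) := by
  have hc : Continuous fun φ => (toOrbitClosure f φ : ℤ → ℂ) :=
    continuous_subtype_val.comp (continuous_toOrbitClosure f)
  have h1 : orbitClosure (f : ℤ →ᵇ ℂ) ⊆ Set.range fun φ => (toOrbitClosure f φ : ℤ → ℂ) := by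
    refine closure_minimal ?_ (isCompact_range hc).isClosed
    rintro _ ⟨m, rfl⟩
    refine ⟨(gelfandShift ^ m) evalZero, funext fun n => ?_⟩
    refine (gelfandShift_zpow_evalZero m (weylTranslate n f)).trans ?_
    exact congrArg (f : ℤ →ᵇ ℂ) (add_comm m n)
  intro y
  obtain ⟨φ, hφ⟩ := h1 y.2
  exact ⟨φ, Subtype.ext hφ⟩

theorem toOrbitClosure_gelfandShift (f : weylAlgebra) (φ : GelfandSpace) :
    toOrbitClosure f (gelfandShift φ) = orbitShift f (toOrbitClosure f φ) := by
  refine Subtype.ext (funext fun n => congrArg φ (Subtype.ext ?_))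
  ext k
  exact congrArg (f : ℤ →ᵇ ℂ) (by ring : k + 1 + n = k + (n + 1))

/-! ### Rational and irrational polynomial phases -/

theorem fourierChar_eq_one_iff (x : ℝ) : (Real.fourierChar x : ℂ) = 1 ↔ ∃ n : ℤ, x = n := by
  rw [Real.fourierChar_apply, Complex.exp_eq_one_iff]
  refine exists_congr fun n => ?_
  have h : (2 * Real.pi * Complex.I : ℂ) ≠ 0 := Complex.two_pi_I_ne_zero
  constructor
  · intro hx
    have h1 : (2 * Real.pi * Complex.I : ℂ) * x = (2 * Real.pi * Complex.I) * n := by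
      rw [mul_comm _ (n : ℂ), ← hx]
      push_cast
      ring
    exact_mod_cast mul_left_cancel₀ h h1
  · rintro rfl
    push_cast
    ring

theorem weylPoly_C (c : ℝ) : weylPoly (C c) = (Real.fourierChar c : ℂ) • (1 : weylAlgebra) := by
  refine Subtype.ext ?_
  ext n
  simp [weylPoly, polyFun_apply]

/-- The phase of a rational polynomial is periodic. -/
theorem exists_weylPoly_taylor_rational (r : ℚ[X]) :
    ∃ Q : ℕ, Q ≠ 0 ∧
      weylPoly (taylor (Q : ℝ) (r.map (algebraMap ℚ ℝ))) = weylPoly (r.map (algebraMap ℚ ℝ)) := by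
  obtain ⟨b, hbmem, hb⟩ := IsLocalization.integerNormalization_spec (nonZeroDivisors ℤ) r
  set s := IsLocalization.integerNormalization (nonZeroDivisors ℤ) r
  have hb0 : b ≠ 0 := nonZeroDivisors.ne_zero hbmem
  have heval : ∀ n : ℤ, ((s.eval n : ℤ) : ℝ) = b * (r.map (algebraMap ℚ ℝ)).eval (n : ℝ) := by
    intro n
    have h1 : ((s.eval n : ℤ) : ℚ) = b * r.eval (n : ℚ) := by
      have h2 := congrArg (eval (n : ℚ)) hb
      rw [eval_smul, zsmul_eq_mul] at h2
      rw [← h2, eval_map_algebraMap]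
      simpa using (aeval_algebraMap_apply ℚ n s).symm
    have h3 : (r.map (algebraMap ℚ ℝ)).eval (n : ℝ) = ((r.eval (n : ℚ) : ℚ) : ℝ) := by
      rw [eval_map_algebraMap]
      simpa using aeval_algebraMap_apply ℝ (n : ℚ) r
    rw [h3]
    exact_mod_cast h1
  -- With s = b r an integer polynomial, b divides Q and hence s(n + Q) - s(n), so r(n + Q) - r(n)
  -- is an integer.
  obtain ⟨Q, hQ0, hQ⟩ : ∃ Q : ℕ, Q ≠ 0 ∧ b ∣ (Q : ℤ) := ⟨b.natAbs, by simpa using hb0, by simp⟩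
  refine ⟨Q, hQ0, Subtype.ext ?_⟩
  ext n
  obtain ⟨k, hk⟩ : b ∣ s.eval (n + Q) - s.eval n := by
    refine dvd_trans ?_ (sub_dvd_eval_sub _ _ s)
    simpa using hQ
  have h4 : (r.map (algebraMap ℚ ℝ)).eval ((n : ℝ) + (Q : ℝ)) =
      k + (r.map (algebraMap ℚ ℝ)).eval (n : ℝ) := by
    have h5 := congrArg (fun z : ℤ => (z : ℝ)) hk
    push_cast at h5
    have h6 := heval (n + Q)
    push_cast at h6
    rw [h6, heval n] at h5
    have hb1 : (b : ℝ) ≠ 0 := by exact_mod_cast hb0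
    refine mul_left_cancel₀ hb1 ?_
    linear_combination h5
  change polyFun _ n = polyFun _ n
  rw [polyFun_apply, polyFun_apply, taylor_eval, h4, AddChar.map_add_eq_mul, Circle.coe_mul,
    (fourierChar_eq_one_iff k).2 ⟨k, rfl⟩, one_mul]

theorem natDegree_taylor_sub_le (c : ℝ) {p : ℝ[X]} {j : ℕ} (hp : p.natDegree ≤ j + 1) :
    (taylor c p - p).natDegree ≤ j := by
  rcases eq_or_ne p 0 with rfl | hp0
  · simp
  rcases eq_or_ne (taylor c p - p) 0 with h0 | h0
  · simp [h0]
  exact Nat.lt_succ_iff.1 ((natDegree_lt_natDegree h0 (degree_taylor_sub_lt c hp0)).trans_le hp)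

/-- The j-th Taylor coefficient is the j-th Hasse derivative at c, here a polynomial of degree at
most one. For c a positive integer, the new top coefficient stays irrational if the old one was. -/
theorem coeff_taylor_sub (c : ℝ) {p : ℝ[X]} {j : ℕ} (hp : p.natDegree ≤ j + 1) :
    (taylor c p - p).coeff j = (j + 1) * p.coeff (j + 1) * c := by
  have h1 : (hasseDeriv j p).natDegree < 2 :=
    (natDegree_hasseDeriv_le p j).trans_lt (by omega)
  rw [coeff_sub, taylor_coeff, eval_eq_sum_range' h1]
  simp [Finset.sum_range_succ, hasseDeriv_coeff, add_comm 1 j]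

/-- A real polynomial is, modulo rational polynomials, either constant or of positive degree with
irrational leading coefficient. -/
theorem exists_rational_decomposition (p : ℝ[X]) :
    (∃ (j : ℕ) (q : ℝ[X]) (r : ℚ[X]), q.natDegree ≤ j + 1 ∧ Irrational (q.coeff (j + 1)) ∧
      p = q + r.map (algebraMap ℚ ℝ)) ∨
    ∃ (c : ℝ) (r : ℚ[X]), p = C c + r.map (algebraMap ℚ ℝ) := by
  have main : ∀ (d : ℕ) (p : ℝ[X]), p.natDegree ≤ d →
      (∃ (j : ℕ) (q : ℝ[X]) (r : ℚ[X]), q.natDegree ≤ j + 1 ∧ Irrational (q.coeff (j + 1)) ∧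
        p = q + r.map (algebraMap ℚ ℝ)) ∨
      ∃ (c : ℝ) (r : ℚ[X]), p = C c + r.map (algebraMap ℚ ℝ) := by
    intro d
    induction d with
    | zero =>
      intro p hp
      exact Or.inr ⟨p.coeff 0, 0, by simpa using eq_C_of_natDegree_le_zero hp⟩
    | succ d ih =>
      intro p hp
      by_cases hirr : Irrational (p.coeff (d + 1))
      · exact Or.inl ⟨d, p, 0, hp, hirr, by simp⟩
      obtain ⟨a, ha⟩ : ∃ a : ℚ, (a : ℝ) = p.coeff (d + 1) := not_not.1 hirr
      have hm : (monomial (d + 1) a).map (algebraMap ℚ ℝ) = monomial (d + 1) (p.coeff (d + 1)) := by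
        rw [map_monomial, ← ha]
        rfl
      have hdeg : (p - monomial (d + 1) (p.coeff (d + 1))).natDegree ≤ d := by
        rw [natDegree_le_iff_coeff_eq_zero]
        intro N hN
        rw [coeff_sub, coeff_monomial]
        split_ifs with h
        · rw [h, sub_self]
        · rw [coeff_eq_zero_of_natDegree_lt (by omega), sub_zero]
      rcases ih _ hdeg with ⟨j, q, r, hq, hqi, h⟩ | ⟨c, r, h⟩
      · refine Or.inl ⟨j, q, r + monomial (d + 1) a, hq, hqi, ?_⟩
        rw [Polynomial.map_add, hm, ← add_assoc, ← h, sub_add_cancel]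
      · refine Or.inr ⟨c, r + monomial (d + 1) a, ?_⟩
        rw [Polynomial.map_add, hm, ← add_assoc, ← h, sub_add_cancel]
  exact main _ p le_rfl

/-! ### Unique ergodicity of the Gelfand flow -/

section UniqueErgodicity

variable [MeasurableSpace GelfandSpace] [BorelSpace GelfandSpace] {μ : Measure GelfandSpace}

theorem integral_weylPoly_taylor (hT : MeasurePreserving gelfandShift μ μ) (n : ℕ) (p : ℝ[X]) :
    ∫ φ : GelfandSpace, φ (weylPoly (taylor (n : ℝ) p)) ∂μ =
      ∫ φ : GelfandSpace, φ (weylPoly p) ∂μ := by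
  induction n with
  | zero => simp
  | succ n ih =>
    rw [← ih, ← integral_comp_eq gelfandShift hT fun φ => φ (weylPoly (taylor (n : ℝ) p))]
    refine integral_congr_ae (Eventually.of_forall fun φ => ?_)
    have h := gelfandShift_zpow_weylPoly 1 φ (taylor (n : ℝ) p)
    rw [zpow_one, taylor_taylor] at h
    simp only [h]
    push_cast
    rw [add_comm]

/-- Translation by a period Q of the rational part multiplies the phase by e(αQ) ≠ 1 but preserves
its integral. -/
theorem integral_weylPoly_eq_zero_of_linear (hT : MeasurePreserving gelfandShift μ μ) {α : ℝ}
    (hα : Irrational α) (c : ℝ) (r : ℚ[X]) :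
    ∫ φ : GelfandSpace, φ (weylPoly (C α * X + C c + r.map (algebraMap ℚ ℝ))) ∂μ = 0 := by
  obtain ⟨Q, hQ, hr⟩ := exists_weylPoly_taylor_rational r
  have h1 := integral_weylPoly_taylor hT Q (C α * X + C c + r.map (algebraMap ℚ ℝ))
  have h2 : taylor (Q : ℝ) (C α * X + C c) = C (α * Q) + (C α * X + C c) := by
    simp only [taylor_apply, add_comp, mul_comp, C_comp, X_comp, C_mul]
    ring
  have h3 : weylPoly (taylor (Q : ℝ) (C α * X + C c + r.map (algebraMap ℚ ℝ))) =
      (Real.fourierChar (α * Q) : ℂ) • weylPoly (C α * X + C c + r.map (algebraMap ℚ ℝ)) := by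
    rw [map_add, weylPoly_add, hr, h2, weylPoly_add, weylPoly_C, weylPoly_add (C α * X + C c),
      smul_mul_assoc, smul_mul_assoc, one_mul]
  simp only [h3, map_smul, smul_eq_mul] at h1
  rw [integral_const_mul, mul_left_eq_self₀] at h1
  refine h1.resolve_left fun h4 => ?_
  obtain ⟨n, hn⟩ := (fourierChar_eq_one_iff _).1 h4
  exact (hα.mul_natCast hQ).ne_int n hn

/-- The integral of a phase with irrational leading coefficient vanishes. -/
theorem integral_weylPoly_eq_zero [IsProbabilityMeasure μ]
    (hT : MeasurePreserving gelfandShift μ μ) (j : ℕ) (q : ℝ[X]) (hq : q.natDegree ≤ j + 1)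
    (hqi : Irrational (q.coeff (j + 1))) (r : ℚ[X]) :
    ∫ φ : GelfandSpace, φ (weylPoly (q + r.map (algebraMap ℚ ℝ))) ∂μ = 0 := by
  induction j generalizing q r with
  | zero =>
    obtain ⟨a, b, rfl⟩ := exists_eq_X_add_C_of_natDegree_le_one hq
    exact integral_weylPoly_eq_zero_of_linear hT (by simpa using hqi) b r
  | succ j ih =>
    set p := q + r.map (algebraMap ℚ ℝ) with hp
    -- Van der Corput differencing: the quotient of two translates of the phase is a translate of
    -- the phase of p(X + h + 1) - p, to which the induction hypothesis applies. The rational part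
    -- is differenced too, hence the generalization over r.
    refine eq_zero_of_integral_eq_of_orthogonal μ (fun n => hatPoly (taylor (n : ℝ) p))
      (fun n φ => norm_character_weylPoly φ _) (fun i k hik => ?_)
      (fun n => integral_weylPoly_taylor hT n p)
    obtain ⟨h, rfl⟩ := Nat.exists_eq_add_of_lt hik
    have h0 : ∀ φ : GelfandSpace, hatPoly (taylor ((i + h + 1 : ℕ) : ℝ) p) φ *
        (starRingEnd ℂ) (hatPoly (taylor (i : ℝ) p) φ) =
        φ (weylPoly (taylor (i : ℝ) (taylor ((h + 1 : ℕ) : ℝ) p - p))) := fun φ => by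
      rw [hatPoly_apply, hatPoly_apply, conj_character_weylPoly, ← map_mul, ← weylPoly_add, map_sub,
        taylor_taylor, ← sub_eq_add_neg]
      push_cast
      rw [add_assoc]
    have h1 : taylor ((h + 1 : ℕ) : ℝ) p - p = (taylor ((h + 1 : ℕ) : ℝ) q - q) +
        (taylor ((h + 1 : ℕ) : ℚ) r - r).map (algebraMap ℚ ℝ) := by
      rw [Polynomial.map_sub, map_taylor, hp, map_add, map_natCast]
      ring
    simp only [h0]
    rw [integral_weylPoly_taylor hT, h1]
    refine ih _ (natDegree_taylor_sub_le _ hq) ?_ _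
    rw [coeff_taylor_sub _ hq]
    have := (hqi.natCast_mul (Nat.succ_ne_zero (j + 1))).mul_natCast (Nat.succ_ne_zero h)
    exact_mod_cast this

/-- The integral of a periodic phase does not depend on the invariant measure. -/
theorem exists_integral_weylPoly_eq_of_periodic {p : ℝ[X]} {Q : ℕ} (hQ : Q ≠ 0)
    (hp : weylPoly (taylor (Q : ℝ) p) = weylPoly p) :
    ∃ c : ℂ, ∀ μ : Measure GelfandSpace, IsProbabilityMeasure μ →
      MeasurePreserving gelfandShift μ μ → ∫ φ : GelfandSpace, φ (weylPoly p) ∂μ = c := by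
  -- Moving the window by one exchanges its first term for the equal term Q places later. A function
  -- on ℤ of period 1 is constant, so the sum of Q consecutive translates is a multiple of 1, on
  -- which all characters agree.
  have hper : Function.Periodic
      (fun n : ℤ => ∑ k ∈ Finset.range Q, polyFun p (n + k)) 1 := by
    intro n
    have h1 : polyFun p (n + Q) = polyFun p n := by
      have := congrArg (fun f : weylAlgebra => (f : ℤ →ᵇ ℂ) n) hp
      simpa [weylPoly, polyFun_apply, taylor_eval] using this
    have h2 := Finset.sum_range_succ' (fun k : ℕ => polyFun p (n + k)) Q
    rw [Finset.sum_range_succ] at h2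
    simp only [Nat.cast_zero, add_zero, h1, add_left_inj] at h2
    beta_reduce
    rw [h2]
    refine Finset.sum_congr rfl fun k _ => congrArg (polyFun p) ?_
    push_cast
    ring
  have hsum : ∑ k ∈ Finset.range Q, weylPoly (taylor (k : ℝ) p) =
      (∑ k ∈ Finset.range Q, polyFun p k) • (1 : weylAlgebra) := by
    refine Subtype.ext ?_
    ext n
    have h1 := hper.int_mul_eq n
    simp only [mul_one, zero_add] at h1
    simp only [AddSubmonoidClass.coe_finsetSum, BoundedContinuousFunction.coe_sum,
      Finset.sum_apply]
    simpa [weylPoly, polyFun_apply, taylor_eval] using h1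
  refine ⟨(Q : ℂ)⁻¹ * ∑ k ∈ Finset.range Q, polyFun p k, fun μ hμ hT => ?_⟩
  have hQ' : (Q : ℂ) ≠ 0 := by exact_mod_cast hQ
  rw [eq_inv_mul_iff_mul_eq₀ hQ']
  calc (Q : ℂ) * ∫ φ : GelfandSpace, φ (weylPoly p) ∂μ
      = ∑ k ∈ Finset.range Q, ∫ φ : GelfandSpace, φ (weylPoly (taylor (k : ℝ) p)) ∂μ := by
        simp [integral_weylPoly_taylor hT]
    _ = ∫ φ : GelfandSpace, ∑ k ∈ Finset.range Q, φ (weylPoly (taylor (k : ℝ) p)) ∂μ :=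
        (integral_finsetSum (Finset.range Q) fun (k : ℕ) _ =>
          integrable_of_continuous μ (hatPoly (taylor (k : ℝ) p)).continuous).symm
    _ = ∫ φ : GelfandSpace, ∑ k ∈ Finset.range Q, polyFun p k ∂μ := by
        refine integral_congr_ae (Eventually.of_forall fun φ => ?_)
        have h1 := congrArg φ hsum
        simpa only [map_sum, map_smul, map_one, smul_eq_mul, mul_one] using h1
    _ = ∑ k ∈ Finset.range Q, polyFun p k := by simp

theorem integral_weylPoly_eq (p : ℝ[X]) {ν : Measure GelfandSpace} [IsProbabilityMeasure μ]
    [IsProbabilityMeasure ν] (hμ : MeasurePreserving gelfandShift μ μ)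
    (hν : MeasurePreserving gelfandShift ν ν) :
    ∫ φ : GelfandSpace, φ (weylPoly p) ∂μ = ∫ φ : GelfandSpace, φ (weylPoly p) ∂ν := by
  rcases exists_rational_decomposition p with ⟨j, q, r, hq, hqi, rfl⟩ | ⟨c, r, rfl⟩
  · rw [integral_weylPoly_eq_zero hμ j q hq hqi r, integral_weylPoly_eq_zero hν j q hq hqi r]
  · obtain ⟨Q, hQ, hr⟩ := exists_weylPoly_taylor_rational r
    obtain ⟨z, hz⟩ := exists_integral_weylPoly_eq_of_periodic
      (p := C c + r.map (algebraMap ℚ ℝ)) hQ (by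
        rw [map_add, taylor_C, weylPoly_add, hr, weylPoly_add])
    rw [hz μ inferInstance hμ, hz ν inferInstance hν]

end UniqueErgodicity

theorem isUniquelyErgodic_gelfandShift : IsUniquelyErgodic gelfandShift := by
  let : MeasurableSpace GelfandSpace := borel GelfandSpace
  have : BorelSpace GelfandSpace := ⟨rfl⟩
  have : Nonempty GelfandSpace := ⟨evalZero⟩
  rw [isUniquelyErgodic_iff]
  obtain ⟨μ, hμ⟩ := exists_invariant_measure gelfandShift
  refine ⟨μ, hμ, fun ν hν => ?_⟩
  obtain ⟨_, _, hTμ⟩ := hμ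
  obtain ⟨_, _, hTν⟩ := hν
  refine measure_ext_of_integral_eq_of_separates star_mem_hatPolyMonoid hatPolyMonoid_separates ?_
  rintro _ ⟨p, rfl⟩
  exact integral_weylPoly_eq p hTν hTμ

theorem isStrictlyErgodic_gelfandShift : IsStrictlyErgodic gelfandShift :=
  ⟨isUniquelyErgodic_gelfandShift, isMinimal_gelfandShift⟩

theorem isStrictlyErgodic_orbitShift (f : weylAlgebra) :
    IsStrictlyErgodic (orbitShift (f : ℤ →ᵇ ℂ)) := by
  have : Nonempty (orbitClosure (f : ℤ →ᵇ ℂ)) := ⟨toOrbitClosure f evalZero⟩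
  exact isStrictlyErgodic_gelfandShift.factor (continuous_toOrbitClosure f)
    (surjective_toOrbitClosure f) (toOrbitClosure_gelfandShift f)

end WeylFlow

end

theorem theorem2p5 :
    WeylFlow.IsStrictlyErgodic WeylFlow.gelfandShift ∧
      ∀ f ∈ WeylFlow.weylAlgebra, WeylFlow.IsStrictlyErgodic (WeylFlow.orbitShift f) :=
  ⟨WeylFlow.isStrictlyErgodic_gelfandShift,
    fun f hf => WeylFlow.isStrictlyErgodic_orbitShift ⟨f, hf⟩⟩
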